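/- Let $\mathbb K$ be a field of characteristic different from $2$. A Lie superalgebra over $\mathbb K$ is a $\mathbb Z_2$-graded vector space $L=L_{\bar 0}\oplus L_{\bar 1}$ with a bilinear bracket satisfying $[L_{\bar\alpha},L_{\bar\beta}]\subseteq L_{\bar\alpha+\bar\beta}$ and, for all homogeneous $x,y,z$, $[x,y]=-(-1)^{|x||y|}[y,x]$ and $[x,[y,z]]=[[x,y],z]+(-1)^{|x||y|}[y,[x,z]]$, and $[x,x]=0$ for even $x$. It has dimension $(m|n)$ if $\dim L_{\bar 0}=m$ and $\dim L_{\bar 1}=n$. Put $L^2=[L,L]$; $L$ is nilpotent if its descending central sequence $L^1=L$, $L^{c+1}=[L^c,L]$ reaches $0$. The Schur multiplier of $L$ is $\mathcal M(L)=(R\cap F^2)/[R,F]$, where $0\to R\to F\to L\to 0$ is a free presentation of $L$ (namely, $F$ is the free Lie superalgebra on the set of homogeneous elements of $L$), and for $L$ of dimension $(m|n)$ put $$s(L)=\tfrac12(m+n-2)(m+n-1)+n+1-\dim\mathcal M(L).$$ **Theorem.** Let $L$ be a finite-dimensional nilpotent Lie superalgebra over $\mathbb K$ of dimension $(m|n)$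 with $m+n>2$, $n\ge 1$ and $\dim L^2=m+n-2$. Then $$(n+m)(n+m-5)+8\;\le\; 2s(L)\;<\;(n+m)(n+m-1)-2m+4 .$$ -/

import Mathlib

universe u v w

/-- A Lie superalgebra over `K`: a module `L` with a decomposition `L = L₀ ⊕ L₁` into an even and an
odd part, and a bilinear bracket compatible with the degrees, which is super skew-symmetric and
satisfies the super Jacobi identity; moreover `[x, x] = 0` for even `x`. The sign `(-1)^{|x||y|}` is
`(-1) ^ (i * j).val` for `x` of degree `i` and `y` of degree `j`. -/
class LieSuperalgebra (K : Type u) (L : Type v) [CommRing K] [AddCommGroup L] [Module K L] where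
  /-- the homogeneous parts, `part 0` even and `part 1` odd -/
  part : ZMod 2 → Submodule K L
  /-- the super bracket -/
  bracket : L →ₗ[K] L →ₗ[K] L
  isCompl : IsCompl (part 0) (part 1)
  bracket_mem : ∀ (i j : ZMod 2) (x y : L), x ∈ part i → y ∈ part j → bracket x y ∈ part (i + j)
  skew : ∀ (i j : ZMod 2) (x y : L), x ∈ part i → y ∈ part j →
    bracket x y = -((-1 : K) ^ (i * j).val • bracket y x)
  jacobi : ∀ (i j : ZMod 2) (x y z : L), x ∈ part i → y ∈ part j → (∃ k, z ∈ part k) →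
    bracket x (bracket y z) =
      bracket (bracket x y) z + (-1 : K) ^ (i * j).val • bracket y (bracket x z)
  bracket_self : ∀ x : L, x ∈ part 0 → bracket x x = 0

namespace LieSuperalgebra

section basic

variable (K : Type u) (L : Type v) [CommRing K] [AddCommGroup L] [Module K L] [LieSuperalgebra K L]

/-- `[A, B]`: the submodule spanned by all brackets `[a, b]` with `a ∈ A` and `b ∈ B`. -/
def brk (A B : Submodule K L) : Submodule K L :=
  Submodule.span K {z | ∃ a ∈ A, ∃ b ∈ B, z = bracket (K := K) a b}

/-- `L² = [L, L]`. -/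
def derived : Submodule K L := brk K L ⊤ ⊤

/-- The descending central sequence, with the index shifted by one: `lowerCentral c` is `L^{c+1}`,
so that `lowerCentral 0 = L` and `lowerCentral (c + 1) = [lowerCentral c, L]`. -/
def lowerCentral : ℕ → Submodule K L
  | 0 => ⊤
  | c + 1 => brk K L (lowerCentral c) ⊤

/-- `L` is nilpotent: its descending central sequence reaches zero. -/
def IsNilpotent : Prop := ∃ c : ℕ, lowerCentral K L c = ⊥

end basic

noncomputable section free

variable (K : Type u) [CommRing K] {X : Type w} (d : X → ZMod 2)

/-- The degree of a nonassociative word in letters `x` of degree `d x`. -/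
def wordDeg : FreeMagma X → ZMod 2
  | .of x => d x
  | .mul a b => wordDeg a + wordDeg b

/-- The product of the free nonassociative algebra, whose basis consists of all nonassociative
words in the letters `X`. -/
def mulWord (X : Type w) :
    (FreeMagma X →₀ K) →ₗ[K] (FreeMagma X →₀ K) →ₗ[K] (FreeMagma X →₀ K) :=
  Finsupp.linearCombination K fun a => Finsupp.linearCombination K fun b =>
    Finsupp.single (FreeMagma.mul a b) (1 : K)

/-- The degree `i` part of the free nonassociative algebra. -/
def wordPart (i : ZMod 2) : Submodule K (FreeMagma X →₀ K) :=
  Finsupp.supported K K {a | wordDeg d a = i}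

/-- The defining relators of a free Lie superalgebra. -/
inductive Relator : (FreeMagma X →₀ K) → Prop
  | skew (i j : ZMod 2) (x y : FreeMagma X →₀ K) (hx : x ∈ wordPart K d i)
      (hy : y ∈ wordPart K d j) :
      Relator (mulWord K X x y + (-1 : K) ^ (i * j).val • mulWord K X y x)
  | jacobi (i j k : ZMod 2) (x y z : FreeMagma X →₀ K) (hx : x ∈ wordPart K d i)
      (hy : y ∈ wordPart K d j) (hz : z ∈ wordPart K d k) :
      Relator (mulWord K X x (mulWord K X y z) - (mulWord K X (mulWord K X x y) z +
        (-1 : K) ^ (i * j).val • mulWord K X y (mulWord K X x z)))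
  | self (x : FreeMagma X →₀ K) (hx : x ∈ wordPart K d 0) : Relator (mulWord K X x x)

/-- The two-sided ideal generated by the relators: the smallest submodule that contains them and is
closed under multiplication by arbitrary elements on either side. -/
def relIdeal : Submodule K (FreeMagma X →₀ K) :=
  sInf {I | (∀ r, Relator K d r → r ∈ I) ∧
    ∀ r ∈ I, ∀ a, mulWord K X a r ∈ I ∧ mulWord K X r a ∈ I}

/-- The free Lie superalgebra over `K` on the set `X` of homogeneous generators, the generator `x`
having degree `d x`. -/
abbrev FreeLS : Type max u w := (FreeMagma X →₀ K) ⧸ relIdeal K d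

variable {K d}

theorem relator_mem {r : FreeMagma X →₀ K} (h : Relator K d r) : r ∈ relIdeal K d := by
  simp only [relIdeal, Submodule.mem_sInf]
  exact fun I hI => hI.1 r h

theorem mul_mem_left {r : FreeMagma X →₀ K} (a : FreeMagma X →₀ K) (h : r ∈ relIdeal K d) :
    mulWord K X a r ∈ relIdeal K d := by
  simp only [relIdeal, Submodule.mem_sInf] at h ⊢
  exact fun I hI => (hI.2 r (h I hI) a).1

theorem mul_mem_right {r : FreeMagma X →₀ K} (a : FreeMagma X →₀ K) (h : r ∈ relIdeal K d) :
    mulWord K X r a ∈ relIdeal K d := by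
  simp only [relIdeal, Submodule.mem_sInf] at h ⊢
  exact fun I hI => (hI.2 r (h I hI) a).2

theorem relIdeal_le {I : Submodule K (FreeMagma X →₀ K)} (h : ∀ r, Relator K d r → r ∈ I)
    (h' : ∀ r ∈ I, ∀ a, mulWord K X a r ∈ I ∧ mulWord K X r a ∈ I) : relIdeal K d ≤ I :=
  sInf_le ⟨h, h'⟩

theorem wordPart_isCompl : IsCompl (wordPart K d 0) (wordPart K d 1) := by
  constructor
  · refine Finsupp.disjoint_supported_supported ?_
    rw [Set.disjoint_left]
    rintro a (h : _ = _) (h' : _ = _)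
    exact zero_ne_one (h.symm.trans h')
  · refine Finsupp.codisjoint_supported_supported ?_
    rw [codisjoint_iff_le_sup]
    intro a _
    have : ∀ i : ZMod 2, i = 0 ∨ i = 1 := by decide
    exact this (wordDeg d a)

theorem single_mem_wordPart (a : FreeMagma X) (c : K) :
    Finsupp.single a c ∈ wordPart K d (wordDeg d a) :=
  Finsupp.single_mem_supported K c rfl

theorem mul_mem_wordPart {i j : ZMod 2} {x y : FreeMagma X →₀ K} (hx : x ∈ wordPart K d i)
    (hy : y ∈ wordPart K d j) : mulWord K X x y ∈ wordPart K d (i + j) := by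
  rw [mulWord, Finsupp.linearCombination_apply, Finsupp.sum, LinearMap.sum_apply]
  refine Submodule.sum_mem _ fun a ha => ?_
  rw [LinearMap.smul_apply, Finsupp.linearCombination_apply, Finsupp.sum]
  refine Submodule.smul_mem _ _ (Submodule.sum_mem _ fun b hb => Submodule.smul_mem _ _ ?_)
  have h1 : wordDeg d a = i := hx ha
  have h2 : wordDeg d b = j := hy hb
  rw [← h1, ← h2]
  exact single_mem_wordPart (FreeMagma.mul a b) 1

theorem mem_homog {i : ZMod 2} {x : FreeMagma X →₀ K} (h : x ∈ relIdeal K d)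
    (hx : x ∈ wordPart K d i) :
    x ∈ (relIdeal K d ⊓ wordPart K d 0) ⊔ (relIdeal K d ⊓ wordPart K d 1) := by
  have h01 : ∀ i : ZMod 2, i = 0 ∨ i = 1 := by decide
  have := h01 i
  rcases this with rfl | rfl
  · exact Submodule.mem_sup_left ⟨h, hx⟩
  · exact Submodule.mem_sup_right ⟨h, hx⟩

theorem relator_homog {r : FreeMagma X →₀ K} (h : Relator K d r) : ∃ i, r ∈ wordPart K d i := by
  cases h with
  | skew i j x y hx hy =>
    exact ⟨i + j, add_mem (mul_mem_wordPart hx hy)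
      (Submodule.smul_mem _ _ (add_comm j i ▸ mul_mem_wordPart hy hx))⟩
  | jacobi i j k x y z hx hy hz =>
    refine ⟨i + (j + k), sub_mem (mul_mem_wordPart hx (mul_mem_wordPart hy hz)) (add_mem ?_
      (Submodule.smul_mem _ _ ?_))⟩
    · rw [← add_assoc]; exact mul_mem_wordPart (mul_mem_wordPart hx hy) hz
    · rw [add_left_comm]; exact mul_mem_wordPart hy (mul_mem_wordPart hx hz)
  | self x hx => exact ⟨0 + 0, mul_mem_wordPart hx hx⟩

theorem relIdeal_homog : relIdeal K d ≤
    (relIdeal K d ⊓ wordPart K d 0) ⊔ (relIdeal K d ⊓ wordPart K d 1) := by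
  refine relIdeal_le (fun r hr => ?_) fun r hr a => ?_
  · obtain ⟨i, hi⟩ := relator_homog hr
    exact mem_homog (relator_mem hr) hi
  · obtain ⟨x, ⟨hx, hx'⟩, y, ⟨hy, hy'⟩, rfl⟩ := Submodule.mem_sup.1 hr
    have ha : a ∈ wordPart K d 0 ⊔ wordPart K d 1 := by
      rw [wordPart_isCompl.sup_eq_top]; trivial
    obtain ⟨b, hb, c, hc, rfl⟩ := Submodule.mem_sup.1 ha
    simp only [map_add, LinearMap.add_apply]
    constructor
    · exact add_mem
        (add_mem (mem_homog (mul_mem_left b hx) (mul_mem_wordPart hb hx'))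
          (mem_homog (mul_mem_left c hx) (mul_mem_wordPart hc hx')))
        (add_mem (mem_homog (mul_mem_left b hy) (mul_mem_wordPart hb hy'))
          (mem_homog (mul_mem_left c hy) (mul_mem_wordPart hc hy')))
    · exact add_mem
        (add_mem (mem_homog (mul_mem_right b hx) (mul_mem_wordPart hx' hb))
          (mem_homog (mul_mem_right b hy) (mul_mem_wordPart hy' hb)))
        (add_mem (mem_homog (mul_mem_right c hx) (mul_mem_wordPart hx' hc))
          (mem_homog (mul_mem_right c hy) (mul_mem_wordPart hy' hc)))

variable (K d) in
/-- The bracket of the free Lie superalgebra, induced by the product of words. -/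
def freeBracket : FreeLS K d →ₗ[K] FreeLS K d →ₗ[K] FreeLS K d :=
  (relIdeal K d).liftQ
    (((relIdeal K d).liftQ ((mulWord K X).compr₂ (relIdeal K d).mkQ).flip fun r hr => by
      refine LinearMap.ext fun a => ?_
      exact (Submodule.Quotient.mk_eq_zero _).2 (mul_mem_left _ hr)).flip) fun r hr => by
    refine LinearMap.ext fun y => ?_
    obtain ⟨a, rfl⟩ := (relIdeal K d).mkQ_surjective y
    exact (Submodule.Quotient.mk_eq_zero _).2 (mul_mem_right _ hr)

theorem freeBracket_mk (a b : FreeMagma X →₀ K) :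
    freeBracket K d ((relIdeal K d).mkQ a) ((relIdeal K d).mkQ b) =
      (relIdeal K d).mkQ (mulWord K X a b) := rfl

/-- The free Lie superalgebra is a Lie superalgebra. -/
instance freeLS : LieSuperalgebra K (FreeLS K d) where
  part i := (wordPart K d i).map (relIdeal K d).mkQ
  bracket := freeBracket K d
  isCompl := by
    constructor
    · rw [Submodule.disjoint_def]
      rintro _ ⟨x, hx, rfl⟩ ⟨y, hy, hxy⟩
      have h : x - y ∈ relIdeal K d :=
        (Submodule.Quotient.eq (relIdeal K d)).1 (show (relIdeal K d).mkQ x = _ from hxy.symm)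
      obtain ⟨x', ⟨hx1, hx2⟩, y', ⟨hy1, hy2⟩, h'⟩ := Submodule.mem_sup.1 (relIdeal_homog h)
      have e : x - x' = y + y' := by
        rw [sub_eq_iff_eq_add, add_assoc, add_comm y' x', h']; abel
      have h0 : x - x' = 0 := Submodule.disjoint_def.1 wordPart_isCompl.disjoint _
        (sub_mem hx hx2) (e ▸ add_mem hy hy2)
      rw [sub_eq_zero.1 h0]
      exact (Submodule.Quotient.mk_eq_zero _).2 hx1
    · rw [codisjoint_iff, ← Submodule.map_sup, wordPart_isCompl.sup_eq_top, Submodule.map_top,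
        Submodule.range_mkQ]
  bracket_mem := by
    rintro i j _ _ ⟨x, hx, rfl⟩ ⟨y, hy, rfl⟩
    exact ⟨_, mul_mem_wordPart hx hy, rfl⟩
  skew := by
    rintro i j _ _ ⟨x, hx, rfl⟩ ⟨y, hy, rfl⟩
    rw [freeBracket_mk, freeBracket_mk, eq_neg_iff_add_eq_zero, ← map_smul, ← map_add]
    exact (Submodule.Quotient.mk_eq_zero _).2 (relator_mem (.skew i j x y hx hy))
  jacobi := by
    rintro i j _ _ _ ⟨x, hx, rfl⟩ ⟨y, hy, rfl⟩ ⟨k, z, hz, rfl⟩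
    simp only [freeBracket_mk]
    rw [← sub_eq_zero, ← map_smul, ← map_add, ← map_sub]
    exact (Submodule.Quotient.mk_eq_zero _).2 (relator_mem (.jacobi i j k x y z hx hy hz))
  bracket_self := by
    rintro _ ⟨x, hx, rfl⟩
    exact (Submodule.Quotient.mk_eq_zero _).2 (relator_mem (.self x hx))

variable (K d) in
/-- The generators of the free Lie superalgebra. -/
def freeGen (x : X) : FreeLS K d := (relIdeal K d).mkQ (Finsupp.single (FreeMagma.of x) 1)

theorem freeGen_mem (x : X) : freeGen K d x ∈ part (K := K) (L := FreeLS K d) (d x) :=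
  ⟨_, single_mem_wordPart (FreeMagma.of x) 1, rfl⟩

section lift

variable {L : Type v} [AddCommGroup L] [Module K L] [LieSuperalgebra K L]

variable (K) in
/-- The value of a word in a Lie superalgebra, given the values of the letters. -/
def evalWord (f : X → L) : FreeMagma X → L
  | .of x => f x
  | .mul a b => bracket (K := K) (evalWord f a) (evalWord f b)

variable (K) in
/-- The linear extension of `evalWord`. -/
def evalLin (f : X → L) : (FreeMagma X →₀ K) →ₗ[K] L := Finsupp.linearCombination K (evalWord K f)

theorem evalLin_mul (f : X → L) (a b : FreeMagma X →₀ K) :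
    evalLin K f (mulWord K X a b) = bracket (K := K) (evalLin K f a) (evalLin K f b) := by
  have : (mulWord K X).compr₂ (evalLin K f) =
      (bracket (K := K) (L := L)).compl₁₂ (evalLin K f) (evalLin K f) := by
    ext a b
    simp [mulWord, evalLin, evalWord]
  exact LinearMap.congr_fun₂ this a b

theorem evalLin_mem {f : X → L} (hf : ∀ x, f x ∈ part (K := K) (L := L) (d x)) {i : ZMod 2}
    {a : FreeMagma X →₀ K} (ha : a ∈ wordPart K d i) : evalLin K f a ∈ part (K := K) (L := L) i := by
  have hw : ∀ w : FreeMagma X, evalWord K f w ∈ part (K := K) (L := L) (wordDeg d w) := by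
    intro w
    induction w with
    | ih1 x => exact hf x
    | ih2 a b iha ihb => exact bracket_mem _ _ _ _ iha ihb
  rw [evalLin, Finsupp.linearCombination_apply, Finsupp.sum]
  refine Submodule.sum_mem _ fun w hw' => Submodule.smul_mem _ _ ?_
  have : wordDeg d w = i := ha hw'
  exact this ▸ hw w

variable (K) in
/-- The homomorphism from the free Lie superalgebra to a Lie superalgebra `L` that extends a given
degree-preserving map on the generators. -/
def freeLift (f : X → L) (hf : ∀ x, f x ∈ part (K := K) (L := L) (d x)) : FreeLS K d →ₗ[K] L :=
  (relIdeal K d).liftQ (evalLin K f) <| relIdeal_le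
    (fun r hr => by
      rw [LinearMap.mem_ker]
      cases hr with
      | skew i j x y hx hy =>
        rw [map_add, map_smul, evalLin_mul, evalLin_mul,
          skew i j _ _ (evalLin_mem hf hx) (evalLin_mem hf hy), neg_add_cancel]
      | jacobi i j k x y z hx hy hz =>
        simp only [map_sub, map_add, map_smul, evalLin_mul]
        rw [sub_eq_zero]
        exact jacobi i j _ _ _ (evalLin_mem hf hx) (evalLin_mem hf hy) ⟨k, evalLin_mem hf hz⟩
      | self x hx => rw [evalLin_mul]; exact bracket_self _ (evalLin_mem hf hx))
    (fun r hr a => by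
      rw [LinearMap.mem_ker] at hr
      simp [evalLin_mul, hr])

theorem freeLift_gen (f : X → L) (hf : ∀ x, f x ∈ part (K := K) (L := L) (d x)) (x : X) :
    freeLift K f hf (freeGen K d x) = f x := by
  change evalLin K f _ = _
  simp [evalLin, evalWord]

theorem freeLift_bracket (f : X → L) (hf : ∀ x, f x ∈ part (K := K) (L := L) (d x)) (a b : FreeLS K d) :
    freeLift K f hf (bracket (K := K) a b) =
      bracket (K := K) (freeLift K f hf a) (freeLift K f hf b) := by
  obtain ⟨a, rfl⟩ := (relIdeal K d).mkQ_surjective a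
  obtain ⟨b, rfl⟩ := (relIdeal K d).mkQ_surjective b
  exact evalLin_mul f a b

theorem freeLift_mem (f : X → L) (hf : ∀ x, f x ∈ part (K := K) (L := L) (d x)) (i : ZMod 2)
    (a : FreeLS K d) (ha : a ∈ part (K := K) (L := FreeLS K d) i) :
    freeLift K f hf a ∈ part (K := K) (L := L) i := by
  obtain ⟨a, ha, rfl⟩ := ha
  exact evalLin_mem hf ha

/-- A bracket-preserving linear map is determined by its values on the generators. -/
theorem free_hom_ext (g h : FreeLS K d →ₗ[K] L)
    (hg : ∀ a b, g (bracket (K := K) a b) = bracket (K := K) (g a) (g b))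
    (hh : ∀ a b, h (bracket (K := K) a b) = bracket (K := K) (h a) (h b))
    (e : ∀ x, g (freeGen K d x) = h (freeGen K d x)) : g = h := by
  have hw : ∀ w : FreeMagma X, g ((relIdeal K d).mkQ (Finsupp.single w 1)) =
      h ((relIdeal K d).mkQ (Finsupp.single w 1)) := by
    intro w
    induction w with
    | ih1 x => exact e x
    | ih2 a b iha ihb =>
      have : (relIdeal K d).mkQ (Finsupp.single (a * b) 1) = bracket (K := K) (L := FreeLS K d)
          ((relIdeal K d).mkQ (Finsupp.single a 1)) ((relIdeal K d).mkQ (Finsupp.single b 1)) := by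
        change _ = (relIdeal K d).mkQ (mulWord K X _ _)
        simp [mulWord, ← FreeMagma.mul_eq]
      rw [this, hg, hh, iha, ihb]
  refine Submodule.linearMap_qext _ ?_
  ext w
  simpa using hw w

end lift

end free

noncomputable section multiplier

variable (K : Type u) (L : Type v) [CommRing K] [AddCommGroup L] [Module K L] [LieSuperalgebra K L]

/-- The homogeneous elements of `L`, each together with a degree. -/
abbrev HomogElt : Type v := {p : ZMod 2 × L // p.2 ∈ part (K := K) (L := L) p.1}

/-- The free Lie superalgebra `F` on the homogeneous elements of `L`. -/
abbrev PresF : Type max u v := FreeLS K (fun p : HomogElt K L => p.1.1)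

/-- The canonical homomorphism `F → L`. -/
def presMap : PresF K L →ₗ[K] L := freeLift K (fun p : HomogElt K L => p.1.2) fun p => p.2

/-- `F → L` is surjective, so `0 → R → F → L → 0` is a free presentation, with `R = ker (F → L)`. -/
theorem presMap_surjective : Function.Surjective (presMap K L) := by
  intro z
  have hz : z ∈ part (K := K) (L := L) 0 ⊔ part (K := K) (L := L) 1 := by
    rw [(isCompl (K := K) (L := L)).sup_eq_top]; trivial
  obtain ⟨x, hx, y, hy, rfl⟩ := Submodule.mem_sup.1 hz
  refine ⟨freeGen K _ (⟨(0, x), hx⟩ : HomogElt K L) + freeGen K _ (⟨(1, y), hy⟩ : HomogElt K L), ?_⟩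
  rw [map_add, presMap, freeLift_gen, freeLift_gen]

/-- `R ∩ F²`. -/
def multNum : Submodule K (PresF K L) := LinearMap.ker (presMap K L) ⊓ derived K (PresF K L)

/-- `[R, F]`. -/
def multDen : Submodule K (PresF K L) := brk K (PresF K L) (LinearMap.ker (presMap K L)) ⊤

/-- The numerator contains the denominator. -/
theorem multDen_le_multNum : multDen K L ≤ multNum K L := by
  refine Submodule.span_le.2 ?_
  rintro _ ⟨a, ha, b, -, rfl⟩
  refine ⟨?_, Submodule.subset_span ⟨a, trivial, b, trivial, rfl⟩⟩
  rw [LinearMap.mem_ker] at ha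
  change presMap K L _ = 0
  rw [presMap, freeLift_bracket]
  change bracket (K := K) (presMap K L a) _ = 0
  rw [ha, map_zero, LinearMap.zero_apply]

/-- The Schur multiplier `M(L) = (R ∩ F²) / [R, F]` of `L`. -/
abbrev SchurMultiplier : Type max u v :=
  (multNum K L) ⧸ (multDen K L).comap (multNum K L).subtype

/-- `s(L) = (m + n - 2)(m + n - 1)/2 + n + 1 - dim M(L)`, where `(m | n)` is the dimension
of `L`. -/
def sInv : ℚ :=
  let m : ℚ := Module.finrank K (part (K := K) (L := L) 0)
  let n : ℚ := Module.finrank K (part (K := K) (L := L) 1)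
  (m + n - 2) * (m + n - 1) / 2 + n + 1 - Module.finrank K (SchurMultiplier K L)

end multiplier

end LieSuperalgebra

/-!
Write `t = m + n`. Since `2 s(L) = (t - 2)(t - 1) + 2 n + 2 - 2 dim M(L)`, the two inequalities say
that `1 ≤ dim M(L) ≤ m + 2 n - 2`. As `L` is nilpotent with `dim L / L² = 2` and has a nonzero odd
part, it is generated by an odd element `y` and a homogeneous element `x`, of degree `i` say, which
are independent modulo `L²` (`exists_generators`); if `x` is odd, then `n ≥ 2`.

Upper bound. The bracket of `F` modulo `[R, F]` factors through a bilinear map `β` on `L`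
(`exists_multPairing`) which satisfies the super skew-symmetry and Jacobi identities
(`IsExteriorPairing`), and whose values span `F² / [R, F]`. By induction along the descending central
sequence, `β(L², L) = β(L², x) + β(L², y)`; hence `F² / [R, F]` is spanned by the image of the map
`L² × L² → F² / [R, F]`, `(u, v) ↦ β(u, x) + β(v, y)`, together with `β(x, x)`, `β(x, y)` and
`β(y, y)`, where `β(x, x) = 0` for even `x`. That map is not injective: the Jacobi identity gives
`β([y, y], x) + 2 β([x, y], y) = 0`, and, if `x` is odd, the same with `x` and `y` exchanged, while
`[x, x]`, `[x, y]` and `[y, y]` do not all vanish. So `dim F² / [R, F] ≤ 2 (t - 2) + 1 + i`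
(`IsExteriorPairing.finrank_le`). The kernel of `F² / [R, F] → L²` is `M(L)`, whence
`dim M(L) ≤ t - 1 + i ≤ m + 2 n - 2` (`finrank_schurMultiplier_add_le`).

Lower bound. Let `F'` be the free Lie superalgebra on `x` and `y`, and `R'` the kernel of `F' → L`.
If `M(L) = 0`, then `R' = [R', F']` (`ker_le_brk_ker`), so that `R'` lies in every term of the
descending central sequence of `F'`. As `L` is nilpotent, `R'` contains `(ad y)ᶜ x` for some `c`. But
`F'` maps to a Lie superalgebra (`ShiftModel`) in which `(ad y)ᶜ x` does not lie in
`lowerCentral (c + 1)` (`iterBracket_notMem`).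
-/

namespace LieSuperalgebra

theorem zmodTwo_cases (i : ZMod 2) : i = 0 ∨ i = 1 := by
  revert i
  decide

/-! ### Graded submodules and the descending central sequence -/

section grading

variable {K : Type u} {L : Type v} [CommRing K] [AddCommGroup L] [Module K L] [LieSuperalgebra K L]

variable (K L) in
theorem exists_add_eq (z : L) :
    ∃ a ∈ part (K := K) (L := L) 0, ∃ b ∈ part (K := K) (L := L) 1, a + b = z := by
  refine Submodule.mem_sup.1 ?_
  rw [(isCompl (K := K) (L := L)).sup_eq_top]
  trivial

theorem eq_of_add_eq {a a' b b' : L} (ha : a ∈ part (K := K) (L := L) 0)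
    (ha' : a' ∈ part (K := K) (L := L) 0) (hb : b ∈ part (K := K) (L := L) 1)
    (hb' : b' ∈ part (K := K) (L := L) 1) (h : a + b = a' + b') : a = a' ∧ b = b' := by
  have e : a - a' = b' - b := by
    rw [sub_eq_sub_iff_add_eq_add, h, add_comm]
  have h0 : a - a' = 0 :=
    Submodule.disjoint_def.1 (isCompl (K := K) (L := L)).disjoint _ (sub_mem ha ha')
      (e ▸ sub_mem hb' hb)
  exact ⟨sub_eq_zero.1 h0, (sub_eq_zero.1 (e.symm.trans h0)).symm⟩

/-- A submodule is graded if it contains the homogeneous components of its elements. -/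
def IsGraded (A : Submodule K L) : Prop :=
  A ≤ (A ⊓ part (K := K) (L := L) 0) ⊔ (A ⊓ part (K := K) (L := L) 1)

theorem isGraded_top : IsGraded (⊤ : Submodule K L) := by
  rw [IsGraded, top_inf_eq, top_inf_eq, (isCompl (K := K) (L := L)).sup_eq_top]

theorem IsGraded.le {A N : Submodule K L} (hA : IsGraded A)
    (h : ∀ i, ∀ a ∈ A, a ∈ part (K := K) (L := L) i → a ∈ N) : A ≤ N :=
  le_trans hA (sup_le (fun a ha => h 0 a ha.1 ha.2) fun a ha => h 1 a ha.1 ha.2)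

/-- A bracket `[A, B]` of graded submodules is spanned by brackets of homogeneous elements. -/
theorem IsGraded.brk_le {A B N : Submodule K L} (hA : IsGraded A) (hB : IsGraded B)
    (h : ∀ i j, ∀ a ∈ A, ∀ b ∈ B, a ∈ part (K := K) (L := L) i → b ∈ part (K := K) (L := L) j →
      bracket (K := K) a b ∈ N) : brk K L A B ≤ N := by
  refine Submodule.span_le.2 ?_
  rintro _ ⟨a, ha, b, hb, rfl⟩
  refine hA.le (N := N.comap (bracket (K := K).flip b)) (fun i a ha hai => ?_) ha
  exact hB.le (N := N.comap (bracket (K := K) a)) (fun j b hb hbj => h i j a ha b hb hai hbj) hb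

theorem bracket_mem_brk {A B : Submodule K L} {a b : L} (ha : a ∈ A) (hb : b ∈ B) :
    bracket (K := K) a b ∈ brk K L A B :=
  Submodule.subset_span ⟨a, ha, b, hb, rfl⟩

theorem brk_mono {A A' B B' : Submodule K L} (hA : A ≤ A') (hB : B ≤ B') :
    brk K L A B ≤ brk K L A' B' :=
  Submodule.span_mono fun _ ⟨a, ha, b, hb, e⟩ => ⟨a, hA ha, b, hB hb, e⟩

theorem IsGraded.brk {A B : Submodule K L} (hA : IsGraded A) (hB : IsGraded B) :
    IsGraded (brk K L A B) := by
  refine hA.brk_le hB fun i j a ha b hb hai hbj => ?_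
  have hm := bracket_mem i j a b hai hbj
  rcases zmodTwo_cases (i + j) with h | h <;> rw [h] at hm
  · exact Submodule.mem_sup_left ⟨bracket_mem_brk ha hb, hm⟩
  · exact Submodule.mem_sup_right ⟨bracket_mem_brk ha hb, hm⟩

theorem IsGraded.bracket_mem_brk_swap {A : Submodule K L} (hA : IsGraded A) {a b : L} (ha : a ∈ A) :
    bracket (K := K) b a ∈ LieSuperalgebra.brk K L A ⊤ := by
  suffices h : LieSuperalgebra.brk K L ⊤ A ≤ LieSuperalgebra.brk K L A ⊤ from
    h (bracket_mem_brk trivial ha)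
  refine isGraded_top.brk_le hA fun i j b _ a ha hbi haj => ?_
  rw [skew i j b a hbi haj]
  exact neg_mem (Submodule.smul_mem _ _ (bracket_mem_brk ha trivial))

variable (K L) in
theorem isGraded_lowerCentral (c : ℕ) : IsGraded (lowerCentral K L c) := by
  induction c with
  | zero => exact isGraded_top
  | succ c ih => exact ih.brk isGraded_top

variable (K L) in
theorem lowerCentral_antitone : Antitone (lowerCentral K L) := by
  refine antitone_nat_of_succ_le fun c => ?_
  induction c with
  | zero => exact le_top
  | succ c ih => exact brk_mono ih le_rfl

/-- If `L² = [L², L]`, then `L² = 0` for nilpotent `L`. -/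
theorem derived_eq_bot_of_le (hnil : IsNilpotent K L) (h : derived K L ≤ lowerCentral K L 2) :
    derived K L = ⊥ := by
  obtain ⟨c, hc⟩ := hnil
  have key : ∀ c, derived K L ≤ lowerCentral K L (c + 1) := by
    intro c
    induction c with
    | zero => exact le_rfl
    | succ c ih => exact h.trans (brk_mono ih le_rfl)
  exact le_bot_iff.1 (((key c).trans (lowerCentral_antitone K L c.le_succ)).trans hc.le)

/-- A nilpotent Lie superalgebra with a nonzero odd part has an odd element outside `L²`: if
`L₁ ⊆ L²`, then `L₁ = [L₀, L₁]`, so that `L₁` lies in every term of the descending central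
sequence. -/
theorem exists_odd_notMem_derived (hnil : IsNilpotent K L)
    (h : part (K := K) (L := L) 1 ≠ ⊥) :
    ∃ y ∈ part (K := K) (L := L) 1, y ∉ derived K L := by
  by_contra! hd
  obtain ⟨c, hc⟩ := hnil
  refine h (le_bot_iff.1 (hc ▸ ?_))
  clear hc
  induction c with
  | zero => exact le_top
  | succ c ih =>
    have key : derived K L ≤ part 0 ⊔ lowerCentral K L (c + 1) := by
      refine isGraded_top.brk_le isGraded_top fun i j a _ b _ ha hb => ?_
      by_cases hi : i = 1
      · subst hi
        exact Submodule.mem_sup_right (bracket_mem_brk (ih ha) trivial)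
      by_cases hj : j = 1
      · subst hj
        exact Submodule.mem_sup_right
          ((isGraded_lowerCentral K L c).bracket_mem_brk_swap (ih hb))
      obtain rfl := (zmodTwo_cases i).resolve_right hi
      obtain rfl := (zmodTwo_cases j).resolve_right hj
      exact Submodule.mem_sup_left (bracket_mem 0 0 a b ha hb)
    intro p hp
    obtain ⟨e, he, g, hg, hpe⟩ := Submodule.mem_sup.1 (key (hd p hp))
    obtain ⟨g0, hg0, g1, hg1, rfl⟩ :=
      Submodule.mem_sup.1 (isGraded_lowerCentral K L (c + 1) hg)
    have := (eq_of_add_eq (zero_mem _) (add_mem he hg0.2) hp hg1.2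
      (by rw [zero_add, add_assoc, hpe])).2
    exact this ▸ hg1.1

end grading

/-! ### Exterior pairings -/

section pairing

variable {K : Type u} {L : Type v} {Q : Type w} [Field K] [AddCommGroup L] [Module K L]
  [LieSuperalgebra K L] [AddCommGroup Q] [Module K Q]

/-- A bilinear map on `L` that satisfies the identities of the bracket of a central extension
of `L`, regarded as a function of the classes in `L` of its arguments. Equivalently, a linear map on
the nonabelian exterior square of `L`. -/
structure IsExteriorPairing (β : L →ₗ[K] L →ₗ[K] Q) : Prop where
  skew : ∀ (i j : ZMod 2) (x y : L), x ∈ part (K := K) (L := L) i → y ∈ part (K := K) (L := L) j →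
    β x y = -((-1 : K) ^ (i * j).val • β y x)
  jacobi : ∀ (i j k : ZMod 2) (x y z : L), x ∈ part (K := K) (L := L) i →
    y ∈ part (K := K) (L := L) j → z ∈ part (K := K) (L := L) k →
    β x (bracket (K := K) y z) =
      β (bracket (K := K) x y) z + (-1 : K) ^ (i * j).val • β y (bracket (K := K) x z)

/-- The map `(u, v) ↦ β(u, x) + β(v, y)` on `L² × L²`. -/
def derivedPairing (β : L →ₗ[K] L →ₗ[K] Q) (x y : L) :
    (derived K L × derived K L) →ₗ[K] Q :=
  ((β.flip x).comp (derived K L).subtype).coprod ((β.flip y).comp (derived K L).subtype)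

theorem derivedPairing_apply (β : L →ₗ[K] L →ₗ[K] Q) (x y : L) (p : derived K L × derived K L) :
    derivedPairing β x y p = β p.1 x + β p.2 y := rfl

variable {β : L →ₗ[K] L →ₗ[K] Q} {x y : L}

/-- If `L` is nilpotent and generated by `x` and `y`, then `β(L², L) = β(L², x) + β(L², y)`. By the
Jacobi identity `β(v, [p, q])` is a combination of `β([v, p], q)` and `β([v, q], p)`, whose first
arguments lie deeper in the descending central sequence than `v`. -/
theorem IsExteriorPairing.mem_range_derivedPairing (hβ : IsExteriorPairing β)
    (hnil : IsNilpotent K L) (hgen : Submodule.span K {x, y} ⊔ derived K L = ⊤)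
    {v : L} (hv : v ∈ derived K L) (u : L) : β v u ∈ LinearMap.range (derivedPairing β x y) := by
  obtain ⟨c, hc⟩ := hnil
  -- The deepest term vanishes, so the induction runs down the descending central sequence.
  have key : ∀ k j, c ≤ j + k → ∀ v ∈ lowerCentral K L (j + 1), ∀ u,
      β v u ∈ LinearMap.range (derivedPairing β x y) := by
    intro k
    induction k with
    | zero =>
      intro j hj v hv u
      have : v ∈ lowerCentral K L c := lowerCentral_antitone K L (by omega : c ≤ j + 1) hv
      rw [hc, Submodule.mem_bot] at this
      rw [this, map_zero, LinearMap.zero_apply]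
      exact zero_mem _
    | succ k ih =>
      intro j hj v hv u
      have ih' := ih (j + 1) (by omega)
      refine (isGraded_lowerCentral K L (j + 1)).le
        (N := (LinearMap.range (derivedPairing β x y)).comap (β.flip u)) (fun i v hv hvi => ?_) hv
      change β v u ∈ LinearMap.range (derivedPairing β x y)
      have hvd : v ∈ derived K L := lowerCentral_antitone K L (by omega : 1 ≤ j + 1) hv
      suffices h : (⊤ : Submodule K L) ≤ (LinearMap.range (derivedPairing β x y)).comap (β v) from
        h (Submodule.mem_top (x := u))
      rw [← hgen]
      refine sup_le (Submodule.span_le.2 ?_) ?_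
      · rintro _ (rfl | rfl)
        · exact ⟨(⟨v, hvd⟩, 0), by simp [derivedPairing_apply]⟩
        · exact ⟨(0, ⟨v, hvd⟩), by simp [derivedPairing_apply]⟩
      · refine isGraded_top.brk_le isGraded_top fun a b p _ q _ hp hq => ?_
        rw [Submodule.mem_comap, hβ.jacobi i a b v p q hvi hp hq,
          hβ.skew _ _ _ _ hp (bracket_mem i b v q hvi hq)]
        exact add_mem (ih' _ (bracket_mem_brk hv trivial) _) (Submodule.smul_mem _ _
          (neg_mem (Submodule.smul_mem _ _ (ih' _ (bracket_mem_brk hv trivial) _))))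
  exact key c 0 (by omega) v hv u

theorem IsExteriorPairing.mem_range_derivedPairing_swap (hβ : IsExteriorPairing β)
    (hnil : IsNilpotent K L) (hgen : Submodule.span K {x, y} ⊔ derived K L = ⊤)
    {v : L} (hv : v ∈ derived K L) (u : L) : β u v ∈ LinearMap.range (derivedPairing β x y) := by
  refine isGraded_top.le (N := (LinearMap.range (derivedPairing β x y)).comap (β.flip v))
    (fun i u _ hu => ?_) (Submodule.mem_top (x := u))
  refine ((isGraded_lowerCentral K L 1).le
    (N := (LinearMap.range (derivedPairing β x y)).comap (β u)) (fun j v hv hvj => ?_) hv)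
  rw [Submodule.mem_comap, hβ.skew i j u v hu hvj]
  exact neg_mem (Submodule.smul_mem _ _ (hβ.mem_range_derivedPairing hnil hgen hv u))

/-- All values of `β` lie in `β(L², x) + β(L², y) + ⟨β(x, x), β(x, y), β(y, y)⟩`. -/
theorem IsExteriorPairing.mem_sup (hβ : IsExteriorPairing β)
    (hnil : IsNilpotent K L) (hgen : Submodule.span K {x, y} ⊔ derived K L = ⊤) {i j : ZMod 2}
    (hx : x ∈ part (K := K) (L := L) i) (hy : y ∈ part (K := K) (L := L) j)
    {S : Submodule K Q} (hxx : β x x ∈ S) (hxy : β x y ∈ S) (hyy : β y y ∈ S) (a b : L) :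
    β a b ∈ LinearMap.range (derivedPairing β x y) ⊔ S := by
  have hyx : β y x ∈ S := by
    rw [hβ.skew j i y x hy hx]
    exact neg_mem (Submodule.smul_mem _ _ hxy)
  have ha : a ∈ Submodule.span K {x, y} ⊔ derived K L := hgen ▸ Submodule.mem_top
  have hb : b ∈ Submodule.span K {x, y} ⊔ derived K L := hgen ▸ Submodule.mem_top
  obtain ⟨p, hp, u, hu, rfl⟩ := Submodule.mem_sup.1 ha
  obtain ⟨q, hq, w, hw, rfl⟩ := Submodule.mem_sup.1 hb
  obtain ⟨a₁, a₂, rfl⟩ := Submodule.mem_span_pair.1 hp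
  obtain ⟨b₁, b₂, rfl⟩ := Submodule.mem_span_pair.1 hq
  have e : ∀ p q, β (p + u) (q + w) = β p q + β u q + β (p + u) w := by
    intro p q
    rw [map_add (β (p + u)), map_add β, LinearMap.add_apply]
  rw [e]
  refine add_mem (add_mem (Submodule.mem_sup_right ?_)
    (Submodule.mem_sup_left (hβ.mem_range_derivedPairing hnil hgen hu _)))
    (Submodule.mem_sup_left (hβ.mem_range_derivedPairing_swap hnil hgen hw _))
  simp only [map_add, map_smul, LinearMap.add_apply, LinearMap.smul_apply]
  exact add_mem
    (Submodule.smul_mem _ _ (add_mem (Submodule.smul_mem _ _ hxx) (Submodule.smul_mem _ _ hyx)))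
    (Submodule.smul_mem _ _ (add_mem (Submodule.smul_mem _ _ hxy) (Submodule.smul_mem _ _ hyy)))

theorem isExteriorPairing_bracket : IsExteriorPairing (bracket (K := K) (L := L)) where
  skew := skew
  jacobi i j k x y z hx hy hz := jacobi i j x y z hx hy ⟨k, hz⟩

/-- If the brackets of the generators `x` and `y` vanish, then so does `L²`. -/
theorem derived_eq_bot_of_generators (hnil : IsNilpotent K L)
    (hgen : Submodule.span K {x, y} ⊔ derived K L = ⊤) {i j : ZMod 2}
    (hx : x ∈ part (K := K) (L := L) i) (hy : y ∈ part (K := K) (L := L) j)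
    (hxx : bracket (K := K) x x = 0) (hxy : bracket (K := K) x y = 0)
    (hyy : bracket (K := K) y y = 0) : derived K L = ⊥ := by
  refine derived_eq_bot_of_le hnil (Submodule.span_le.2 ?_)
  rintro _ ⟨a, -, b, -, rfl⟩
  have h := isExteriorPairing_bracket.mem_sup hnil hgen hx hy (S := ⊥) hxx hxy hyy a b
  rw [sup_bot_eq] at h
  obtain ⟨p, hp⟩ := h
  rw [← hp, derivedPairing_apply]
  exact add_mem (bracket_mem_brk p.1.2 trivial) (bracket_mem_brk p.2.2 trivial)

/-- The Jacobi identity for `x`, `y`, `y` with `y` odd. -/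
theorem IsExteriorPairing.jacobi_odd (hβ : IsExteriorPairing β) {i : ZMod 2}
    (hx : x ∈ part (K := K) (L := L) i) (hy : y ∈ part (K := K) (L := L) 1) :
    β (bracket (K := K) y y) x + (2 : K) • β (bracket (K := K) x y) y = 0 := by
  have h1 := hβ.jacobi i 1 1 x y y hx hy hy
  have h2 := hβ.skew i (1 + 1) x _ hx (bracket_mem 1 1 y y hy hy)
  have h3 := hβ.skew 1 (i + 1) y _ hy (bracket_mem i 1 x y hx hy)
  rw [h2, h3] at h1
  have e0 : (1 + 1 : ZMod 2) = 0 := by decide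
  have e1 : (1 : ZMod 2).val = 1 := rfl
  rcases zmodTwo_cases i with rfl | rfl <;> simp [e0, e1] at h1 <;> linear_combination (norm := module) (-1 : K) • h1

/-- The map `(u, v) ↦ β(u, x) + β(v, y)` on `L² × L²` is not injective, because of the Jacobi
identities for `x`, `y`, `y` and, if `x` is odd, for `y`, `x`, `x`. -/
theorem IsExteriorPairing.exists_ne_zero (hβ : IsExteriorPairing β) (h2 : (2 : K) ≠ 0)
    (hnil : IsNilpotent K L) (hgen : Submodule.span K {x, y} ⊔ derived K L = ⊤) {i : ZMod 2}
    (hx : x ∈ part (K := K) (L := L) i) (hy : y ∈ part (K := K) (L := L) 1)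
    (hL : derived K L ≠ ⊥) : ∃ p, p ≠ 0 ∧ derivedPairing β x y p = 0 := by
  have hd : ∀ a b : L, bracket (K := K) a b ∈ derived K L :=
    fun a b => bracket_mem_brk trivial trivial
  by_contra! hinj
  have h0 : bracket (K := K) y y = 0 ∧ bracket (K := K) x y = 0 := by
    by_contra hne
    refine hinj (⟨_, hd y y⟩, (2 : K) • ⟨_, hd x y⟩) (fun h => hne ?_) ?_
    · have h' := Prod.ext_iff.1 h
      exact ⟨congrArg Subtype.val h'.1,
        congrArg Subtype.val ((smul_eq_zero.1 h'.2).resolve_left h2)⟩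
    · simpa [derivedPairing_apply] using hβ.jacobi_odd hx hy
  have hxx : bracket (K := K) x x = 0 := by
    rcases zmodTwo_cases i with rfl | rfl
    · exact bracket_self x hx
    by_contra hne
    refine hinj (0, ⟨_, hd x x⟩) (fun h => hne ?_) ?_
    · exact congrArg Subtype.val (Prod.ext_iff.1 h).2
    · have h := hβ.jacobi_odd hy hx
      rw [LieSuperalgebra.skew 1 1 y x hy hx, h0.2] at h
      simpa [derivedPairing_apply] using h
  exact hL (derived_eq_bot_of_generators hnil hgen hx hy hxx h0.2 h0.1)

/-- The values of an exterior pairing span a space of dimension at most `2 dim L² - 1 + 2` if `x` is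
even and at most `2 dim L² - 1 + 3` if `x` is odd. -/
theorem IsExteriorPairing.finrank_le (hβ : IsExteriorPairing β) (h2 : (2 : K) ≠ 0)
    [FiniteDimensional K L]
    (hnil : IsNilpotent K L) (hgen : Submodule.span K {x, y} ⊔ derived K L = ⊤) {i : ZMod 2}
    (hx : x ∈ part (K := K) (L := L) i) (hy : y ∈ part (K := K) (L := L) 1)
    (hL : derived K L ≠ ⊥) {N : Submodule K Q}
    (hN : N ≤ Submodule.span K {q | ∃ a b, q = β a b}) :
    FiniteDimensional K N ∧
      Module.finrank K N ≤ 2 * Module.finrank K (derived K L) + 1 + i.val := by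
  obtain ⟨p, hp0, hp⟩ := hβ.exists_ne_zero h2 hnil hgen hx hy hL
  have hker : 0 < Module.finrank K (LinearMap.ker (derivedPairing β x y)) := by
    have : Nontrivial (LinearMap.ker (derivedPairing β x y)) :=
      ⟨⟨⟨p, hp⟩, 0, fun h => hp0 (congrArg Subtype.val h)⟩⟩
    exact Module.finrank_pos
  have hrk := LinearMap.finrank_range_add_finrank_ker (derivedPairing β x y)
  rw [Module.finrank_prod] at hrk
  have main : ∀ s : Finset Q, β x x ∈ Submodule.span K (s : Set Q) →
      β x y ∈ Submodule.span K (s : Set Q) → β y y ∈ Submodule.span K (s : Set Q) →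
      s.card ≤ 2 + i.val → FiniteDimensional K N ∧
      Module.finrank K N ≤ 2 * Module.finrank K (derived K L) + 1 + i.val := by
    intro s hxx hxy hyy hs
    have hle : N ≤ LinearMap.range (derivedPairing β x y) ⊔ Submodule.span K (s : Set Q) := by
      refine hN.trans (Submodule.span_le.2 ?_)
      rintro _ ⟨a, b, rfl⟩
      exact hβ.mem_sup hnil hgen hx hy hxx hxy hyy a b
    have : FiniteDimensional K (Submodule.span K (s : Set Q)) :=
      FiniteDimensional.span_finset K s
    refine ⟨Submodule.finiteDimensional_of_le hle, ?_⟩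
    have h1 := Submodule.finrank_mono hle
    have h3 := Submodule.finrank_add_le_finrank_add_finrank
      (LinearMap.range (derivedPairing β x y)) (Submodule.span K (s : Set Q))
    have h4 : Module.finrank K (Submodule.span K (s : Set Q)) ≤ 2 + i.val :=
      (finrank_span_finset_le_card (R := K) s).trans hs
    omega
  classical
  rcases zmodTwo_cases i with rfl | rfl
  · have hxx : β x x = 0 := by
      have h := hβ.skew 0 0 x x hx hx
      simp only [mul_zero, ZMod.val_zero, pow_zero, one_smul] at h
      have h' : (2 : K) • β x x = 0 := by
        rw [two_smul]
        exact eq_neg_iff_add_eq_zero.1 h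
      exact (smul_eq_zero.1 h').resolve_left h2
    refine main {β x y, β y y} (hxx ▸ zero_mem _) (Submodule.subset_span (by simp))
      (Submodule.subset_span (by simp)) Finset.card_le_two
  · exact main {β x x, β x y, β y y} (Submodule.subset_span (by simp))
      (Submodule.subset_span (by simp)) (Submodule.subset_span (by simp)) Finset.card_le_three

end pairing

/-! ### A Lie superalgebra of infinite nilpotency class -/

noncomputable section model

variable (K : Type u) [Field K]

/-- The shift `(f₀, f₁, …) ↦ (0, f₀, f₁, …)`. -/
def seqShift : (ℕ → K) →ₗ[K] (ℕ → K) where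
  toFun f k := match k with
    | 0 => 0
    | k + 1 => f k
  map_add' f g := by ext k; cases k <;> simp
  map_smul' a f := by ext k; cases k <;> simp

/-- The sequences supported on the indices `k` with `k + i ≡ j` modulo 2. -/
def seqPart (i j : ZMod 2) : Submodule K (ℕ → K) where
  carrier := {f | ∀ k : ℕ, (k : ZMod 2) + i ≠ j → f k = 0}
  add_mem' hf hg k hk := by simp [hf k hk, hg k hk]
  zero_mem' _ _ := rfl
  smul_mem' a f hf k hk := by simp [hf k hk]

/-- The parity automorphism, `1` on `seqPart K i 0` and `-1` on `seqPart K i 1`. -/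
def seqParity (i : ZMod 2) : (ℕ → K) →ₗ[K] (ℕ → K) where
  toFun f k := (-1) ^ ((k : ZMod 2) + i).val * f k
  map_add' f g := by ext k; simp [mul_add]
  map_smul' a f := by ext k; simp [mul_left_comm]

variable {K}

theorem seqShift_mem {i j : ZMod 2} {f : ℕ → K} (hf : f ∈ seqPart K i j) :
    seqShift K f ∈ seqPart K i (j + 1) := by
  intro k hk
  cases k with
  | zero => rfl
  | succ k =>
    refine hf k fun h => hk ?_
    rw [← h]
    push_cast
    ring

theorem seqParity_shift (i : ZMod 2) (f : ℕ → K) :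
    seqParity K i (seqShift K f) = -seqShift K (seqParity K i f) := by
  ext k
  cases k with
  | zero => simp [seqParity, seqShift]
  | succ k =>
    have h : ∀ a : ZMod 2, (-1 : K) ^ (a + 1).val = -(-1) ^ a.val := by
      intro a
      have e0 : (1 + 1 : ZMod 2) = 0 := by decide
      have e1 : (1 : ZMod 2).val = 1 := rfl
      rcases zmodTwo_cases a with rfl | rfl <;> simp [e0, e1]
    have e : ((k + 1 : ℕ) : ZMod 2) + i = k + i + 1 := by push_cast; ring
    change (-1) ^ (((k + 1 : ℕ) : ZMod 2) + i).val * f k = -((-1) ^ ((k : ZMod 2) + i).val * f k)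
    rw [e, h, neg_mul]

theorem seqParity_apply {i j : ZMod 2} {f : ℕ → K} (hf : f ∈ seqPart K i j) :
    seqParity K i f = (-1 : K) ^ j.val • f := by
  ext k
  by_cases h : (k : ZMod 2) + i = j
  · simp [seqParity, h]
  · simp [seqParity, hf k h]

theorem seqPart_isCompl (i : ZMod 2) : IsCompl (seqPart K i 0) (seqPart K i 1) := by
  constructor
  · rw [Submodule.disjoint_def]
    intro f hf hf'
    ext k
    rcases zmodTwo_cases ((k : ZMod 2) + i) with h | h
    · exact hf' k (by simp [h])
    · exact hf k (by simp [h])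
  · rw [codisjoint_iff_le_sup]
    intro f _
    refine Submodule.mem_sup.2 ⟨fun k => if (k : ZMod 2) + i = 0 then f k else 0,
      fun k hk => if_neg hk, fun k => if (k : ZMod 2) + i = 0 then 0 else f k, fun k hk => ?_, ?_⟩
    · exact if_pos ((zmodTwo_cases _).resolve_right hk)
    · ext k
      by_cases h : (k : ZMod 2) + i = 0 <;> simp [h]

variable (K) in
/-- The underlying space of a Lie superalgebra of infinite nilpotency class: `(a, b, f)` stands for
`a y + b w + f`, where `y` is odd, `w` is even with `[y, y] = 2 w`, and the sequences `f` form an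
abelian ideal on which `y` acts by the shift and `w` by its square. The parameter is the degree
of the sequence `(1, 0, 0, …)`. -/
def ShiftModel (_ : ZMod 2) : Type u := K × K × (ℕ → K)

instance (i : ZMod 2) : AddCommGroup (ShiftModel K i) :=
  inferInstanceAs (AddCommGroup (K × K × (ℕ → K)))

instance (i : ZMod 2) : Module K (ShiftModel K i) :=
  inferInstanceAs (Module K (K × K × (ℕ → K)))

namespace ShiftModel

/-- The homogeneous parts of `ShiftModel K i`. -/
def homogPart (i j : ZMod 2) : Submodule K (ShiftModel K i) where
  carrier := {p | (j = 0 → p.1 = 0) ∧ (j = 1 → p.2.1 = 0) ∧ p.2.2 ∈ seqPart K i j}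
  add_mem' {p q} hp hq :=
    ⟨fun h => by change p.1 + q.1 = 0; rw [hp.1 h, hq.1 h, add_zero],
      fun h => by change p.2.1 + q.2.1 = 0; rw [hp.2.1 h, hq.2.1 h, add_zero],
      add_mem hp.2.2 hq.2.2⟩
  zero_mem' := ⟨fun _ => rfl, fun _ => rfl, zero_mem _⟩
  smul_mem' a p hp :=
    ⟨fun h => by change a * p.1 = 0; rw [hp.1 h, mul_zero],
      fun h => by change a * p.2.1 = 0; rw [hp.2.1 h, mul_zero],
      Submodule.smul_mem _ _ hp.2.2⟩

variable (K) in
/-- The bracket of `ShiftModel K i`. The sign in `[f, y] = ± S f` is produced by the parity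
automorphism. -/
def brkt (i : ZMod 2) : ShiftModel K i →ₗ[K] ShiftModel K i →ₗ[K] ShiftModel K i :=
  LinearMap.mk₂ K (fun p q => (0, 2 * p.1 * q.1,
      p.1 • seqShift K q.2.2 + p.2.1 • seqShift K (seqShift K q.2.2) -
        q.1 • seqShift K (seqParity K i p.2.2) - q.2.1 • seqShift K (seqShift K p.2.2)))
    (by
      rintro ⟨a, b, f⟩ ⟨a', b', f'⟩ ⟨c, d, g⟩
      refine Prod.ext (add_zero 0).symm (Prod.ext ?_ ?_)
      · change 2 * (a + a') * c = 2 * a * c + 2 * a' * c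
        ring
      · change (a + a') • _ + (b + b') • _ - c • seqShift K (seqParity K i (f + f')) -
          d • seqShift K (seqShift K (f + f')) = (_ + _ - _ - _) + (_ + _ - _ - _)
        simp only [map_add]
        module)
    (by
      rintro t ⟨a, b, f⟩ ⟨c, d, g⟩
      refine Prod.ext (mul_zero t).symm (Prod.ext ?_ ?_)
      · change 2 * (t * a) * c = t * (2 * a * c)
        ring
      · change (t * a) • _ + (t * b) • _ - c • seqShift K (seqParity K i (t • f)) -
          d • seqShift K (seqShift K (t • f)) = t • (_ + _ - _ - _)
        simp only [map_smul]
        module)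
    (by
      rintro ⟨c, d, g⟩ ⟨a, b, f⟩ ⟨a', b', f'⟩
      refine Prod.ext (add_zero 0).symm (Prod.ext ?_ ?_)
      · change 2 * c * (a + a') = 2 * c * a + 2 * c * a'
        ring
      · change c • seqShift K (f + f') + d • seqShift K (seqShift K (f + f')) - (a + a') • _ -
          (b + b') • _ = (_ + _ - _ - _) + (_ + _ - _ - _)
        simp only [map_add]
        module)
    (by
      rintro t ⟨c, d, g⟩ ⟨a, b, f⟩
      refine Prod.ext (mul_zero t).symm (Prod.ext ?_ ?_)
      · change 2 * c * (t * a) = t * (2 * c * a)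
        ring
      · change c • seqShift K (t • f) + d • seqShift K (seqShift K (t • f)) - (t * a) • _ -
          (t * b) • _ = t • (_ + _ - _ - _)
        simp only [map_smul]
        module)

theorem brkt_apply {i : ZMod 2} (a b : K) (f : ℕ → K) (c d : K) (g : ℕ → K) :
    brkt K i (a, b, f) (c, d, g) = (0, 2 * a * c,
      a • seqShift K g + b • seqShift K (seqShift K g) -
        c • seqShift K (seqParity K i f) - d • seqShift K (seqShift K f)) := rfl

instance (i : ZMod 2) : LieSuperalgebra K (ShiftModel K i) where
  part := homogPart i
  bracket := brkt K i
  isCompl := by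
    constructor
    · rw [Submodule.disjoint_def]
      rintro ⟨a, b, f⟩ h h'
      exact Prod.ext (h.1 rfl) (Prod.ext (h'.2.1 rfl)
        (Submodule.disjoint_def.1 (seqPart_isCompl i).disjoint f h.2.2 h'.2.2))
    · rw [codisjoint_iff_le_sup]
      rintro ⟨a, b, f⟩ -
      have hf : f ∈ seqPart K i 0 ⊔ seqPart K i 1 := by
        rw [(seqPart_isCompl i).sup_eq_top]; trivial
      obtain ⟨f₀, h₀, f₁, h₁, rfl⟩ := Submodule.mem_sup.1 hf
      exact Submodule.mem_sup.2 ⟨((0, b, f₀) : K × K × (ℕ → K)),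
        ⟨fun _ => rfl, fun h => absurd h zero_ne_one, h₀⟩, ((a, 0, f₁) : K × K × (ℕ → K)),
        ⟨fun h => absurd h one_ne_zero, fun _ => rfl, h₁⟩,
        Prod.ext (zero_add a) (Prod.ext (add_zero b) rfl)⟩
  bracket_mem := by
    have e : (1 + 1 : ZMod 2) = 0 := by decide
    rintro j k ⟨a, b, f⟩ ⟨c, d, g⟩ ⟨hx1, hx2, hx⟩ ⟨hy1, hy2, hy⟩
    rw [brkt_apply]
    dsimp only at hx1 hx2 hx hy1 hy2 hy
    have hf := seqShift_mem hx
    have hff := seqShift_mem hf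
    have hg := seqShift_mem hy
    have hgg := seqShift_mem hg
    refine ⟨fun _ => rfl, fun h => ?_, ?_⟩ <;> dsimp only
    · rcases zmodTwo_cases j with rfl | rfl
      · simp [hx1 rfl]
      rcases zmodTwo_cases k with rfl | rfl
      · simp [hy1 rfl]
      · exact absurd h (by decide)
    · rw [seqParity_apply hx, map_smul]
      rcases zmodTwo_cases j with rfl | rfl <;> rcases zmodTwo_cases k with rfl | rfl <;>
        simp_all [sub_mem, Submodule.smul_mem]
      exact sub_mem (Submodule.smul_mem _ _ hg)
        (Submodule.smul_mem _ _ (Submodule.smul_mem _ _ hf))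
  skew := by
    have e1 : (1 : ZMod 2).val = 1 := rfl
    rintro j k ⟨a, b, f⟩ ⟨c, d, g⟩ ⟨hx1, hx2, hx⟩ ⟨hy1, hy2, hy⟩
    dsimp only at hx1 hx2 hx hy1 hy2 hy
    rw [brkt_apply, brkt_apply, seqParity_apply hx, seqParity_apply hy]
    refine Prod.ext ?_ (Prod.ext ?_ ?_)
    · change (0 : K) = -(_ * 0)
      simp
    · change 2 * a * c = -((-1 : K) ^ (j * k).val * (2 * c * a))
      rcases zmodTwo_cases j with rfl | rfl <;> rcases zmodTwo_cases k with rfl | rfl <;> simp_all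
      ring
    · change _ = -((-1 : K) ^ (j * k).val • (_ + _ - _ - _))
      simp only [map_smul]
      rcases zmodTwo_cases j with rfl | rfl <;> rcases zmodTwo_cases k with rfl | rfl <;> simp_all
  jacobi := by
    have e1 : (1 : ZMod 2).val = 1 := rfl
    rintro j k ⟨a, b, f⟩ ⟨c, d, g⟩ ⟨a', b', f'⟩ ⟨hx1, hx2, hx⟩ ⟨hy1, hy2, hy⟩ ⟨l, hz1, hz2, hz⟩
    dsimp only at hx1 hx2 hx hy1 hy2 hy hz1 hz2 hz
    simp only [brkt_apply, map_add, map_sub, map_smul, seqParity_shift, seqParity_apply hx,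
      seqParity_apply hy, map_neg]
    refine Prod.ext ?_ (Prod.ext ?_ ?_)
    · change (0 : K) = 0 + _ * 0
      simp
    · change 2 * a * 0 = 2 * 0 * _ + _ * (2 * c * 0)
      simp
    · change _ + _ - _ - _ = (_ + _ - _ - _) + (-1 : K) ^ (j * k).val • (_ + _ - _ - _)
      rcases zmodTwo_cases j with rfl | rfl <;> rcases zmodTwo_cases k with rfl | rfl <;>
        simp only [hx1, hx2, hy1, hy2, e1, ZMod.val_zero, mul_zero, zero_mul, mul_one, pow_zero,
          pow_one] <;> module
  bracket_self := by
    rintro ⟨a, b, f⟩ ⟨hx1, hx2, hx⟩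
    dsimp only at hx1 hx2 hx
    rw [brkt_apply, hx1 rfl]
    refine Prod.ext rfl (Prod.ext ?_ ?_)
    · change 2 * 0 * (0 : K) = 0
      simp
    · change _ + _ - _ - _ = (0 : ℕ → K)
      simp

/-- The filtration of `ShiftModel K i` in which `y` has level `0`, `w` has level `1`, and a sequence
that starts at index `c` has level `c`. -/
def filtration (i : ZMod 2) (c : ℕ) : Submodule K (ShiftModel K i) where
  carrier := {p | (1 ≤ c → p.1 = 0) ∧ (2 ≤ c → p.2.1 = 0) ∧ ∀ k < c, p.2.2 k = 0}
  add_mem' {p q} hp hq :=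
    ⟨fun h => by change p.1 + q.1 = 0; rw [hp.1 h, hq.1 h, add_zero],
      fun h => by change p.2.1 + q.2.1 = 0; rw [hp.2.1 h, hq.2.1 h, add_zero],
      fun k hk => by change p.2.2 k + q.2.2 k = 0; rw [hp.2.2 k hk, hq.2.2 k hk, add_zero]⟩
  zero_mem' := ⟨fun _ => rfl, fun _ => rfl, fun _ _ => rfl⟩
  smul_mem' a p hp :=
    ⟨fun h => by change a * p.1 = 0; rw [hp.1 h, mul_zero],
      fun h => by change a * p.2.1 = 0; rw [hp.2.1 h, mul_zero],
      fun k hk => by change a * p.2.2 k = 0; rw [hp.2.2 k hk, mul_zero]⟩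

variable (K) in
theorem lowerCentral_le_filtration (i : ZMod 2) (c : ℕ) :
    lowerCentral K (ShiftModel K i) c ≤ filtration i c := by
  induction c with
  | zero => exact fun p _ => ⟨fun h => by omega, fun h => by omega, fun k hk => by omega⟩
  | succ c ih =>
    refine Submodule.span_le.2 ?_
    rintro _ ⟨⟨a, b, f⟩, hp, ⟨a', b', g⟩, -, rfl⟩
    obtain ⟨h1, h2, h3⟩ := ih hp
    dsimp only at h1 h2 h3
    change brkt K i _ _ ∈ filtration i (c + 1)
    rw [brkt_apply]
    refine ⟨fun _ => rfl, fun h => ?_, fun k hk => ?_⟩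
    · change 2 * a * a' = 0
      rw [h1 (by omega), mul_zero, zero_mul]
    · change a * seqShift K g k + b * seqShift K (seqShift K g) k -
        a' * seqShift K (seqParity K i f) k - b' * seqShift K (seqShift K f) k = 0
      match k with
      | 0 => simp [seqShift]
      | 1 => simp [seqShift, seqParity, h1 (by omega), h3 0 (by omega)]
      | k + 2 =>
        simp [seqShift, seqParity, h1 (by omega), h2 (by omega), h3 (k + 1) (by omega),
          h3 k (by omega)]

/-- The element `y`. -/
def genY (i : ZMod 2) : ShiftModel K i := ((1, 0, 0) : K × K × (ℕ → K))

/-- The sequence with a single entry `1` at index `k`. -/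
def genSeq (i : ZMod 2) (k : ℕ) : ShiftModel K i := ((0, 0, Pi.single k 1) : K × K × (ℕ → K))

theorem genY_mem (i : ZMod 2) : genY i ∈ part (K := K) (L := ShiftModel K i) 1 :=
  ⟨fun h => absurd h one_ne_zero, fun _ => rfl, zero_mem _⟩

theorem genSeq_zero_mem (i : ZMod 2) : genSeq i 0 ∈ part (K := K) (L := ShiftModel K i) i := by
  refine ⟨fun _ => rfl, fun _ => rfl, fun k hk => Pi.single_eq_of_ne (fun h => hk ?_) _⟩
  simp [h]

theorem bracket_genY_genSeq (i : ZMod 2) (k : ℕ) :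
    bracket (K := K) (genY i : ShiftModel K i) (genSeq i k) = genSeq i (k + 1) := by
  change brkt K i (1, 0, 0) (0, 0, Pi.single k 1) = _
  rw [brkt_apply]
  refine Prod.ext rfl (Prod.ext (mul_zero _) ?_)
  change _ = Pi.single (k + 1) 1
  ext l
  cases l <;> simp [seqShift, Pi.single_apply]

theorem genSeq_notMem (i : ZMod 2) (k : ℕ) :
    (genSeq i k : ShiftModel K i) ∉ lowerCentral K (ShiftModel K i) (k + 1) := by
  intro h
  have := (lowerCentral_le_filtration K i _ h).2.2 k k.lt_succ_self
  change (Pi.single k 1 : ℕ → K) k = 0 at this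
  simp at this

end ShiftModel

end model

/-! ### Homomorphisms and generators -/

section hom

variable {K : Type u} {L : Type v} {L' : Type w} [CommRing K] [AddCommGroup L] [Module K L]
  [LieSuperalgebra K L] [AddCommGroup L'] [Module K L'] [LieSuperalgebra K L']

theorem isGraded_ker {g : L →ₗ[K] L'} (hg : ∀ i, ∀ a ∈ part (K := K) (L := L) i,
    g a ∈ part (K := K) (L := L') i) : IsGraded (LinearMap.ker g) := by
  intro a ha
  obtain ⟨a₀, h₀, a₁, h₁, rfl⟩ := exists_add_eq K L a
  rw [LinearMap.mem_ker, map_add] at ha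
  have h := eq_of_add_eq (hg 0 a₀ h₀) (zero_mem _) (hg 1 a₁ h₁) (zero_mem _)
    (ha.trans (add_zero 0).symm)
  exact Submodule.add_mem_sup ⟨h.1, h₀⟩ ⟨h.2, h₁⟩

/-- A homogeneous element in the image of a degree-preserving map has a homogeneous preimage of the
same degree. -/
theorem exists_homog_preimage {g : L →ₗ[K] L'} (hg : ∀ i, ∀ a ∈ part (K := K) (L := L) i,
    g a ∈ part (K := K) (L := L') i) {i : ZMod 2} (a : L)
    (ha : g a ∈ part (K := K) (L := L') i) : ∃ b ∈ part (K := K) (L := L) i, g b = g a := by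
  obtain ⟨a₀, h₀, a₁, h₁, rfl⟩ := exists_add_eq K L a
  rcases zmodTwo_cases i with rfl | rfl
  · exact ⟨a₀, h₀, (eq_of_add_eq (hg 0 a₀ h₀) ha (hg 1 a₁ h₁) (zero_mem _)
      (by rw [add_zero, map_add])).1⟩
  · exact ⟨a₁, h₁, (eq_of_add_eq (hg 0 a₀ h₀) (zero_mem _) (hg 1 a₁ h₁) ha
      (by rw [zero_add, map_add])).2⟩

theorem map_brk_le {g : L →ₗ[K] L'}
    (hg : ∀ a b, g (bracket (K := K) a b) = bracket (K := K) (g a) (g b))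
    {A B : Submodule K L} {A' B' : Submodule K L'} (hA : A ≤ A'.comap g) (hB : B ≤ B'.comap g) :
    brk K L A B ≤ (brk K L' A' B').comap g := by
  refine Submodule.span_le.2 ?_
  rintro _ ⟨a, ha, b, hb, rfl⟩
  change g _ ∈ brk K L' A' B'
  rw [hg]
  exact bracket_mem_brk (hA ha) (hB hb)

theorem lowerCentral_le_comap {g : L →ₗ[K] L'}
    (hg : ∀ a b, g (bracket (K := K) a b) = bracket (K := K) (g a) (g b)) (c : ℕ) :
    lowerCentral K L c ≤ (lowerCentral K L' c).comap g := by
  induction c with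
  | zero => exact fun _ _ => Submodule.mem_top
  | succ c ih => exact map_brk_le hg ih fun _ _ => Submodule.mem_top

/-- A subalgebra of a nilpotent Lie superalgebra that spans `L` together with `L²` is `L`. -/
theorem eq_top_of_sup_derived (hnil : IsNilpotent K L) {T : Submodule K L}
    (hT : ∀ a ∈ T, ∀ b ∈ T, bracket (K := K) a b ∈ T) (h : T ⊔ derived K L = ⊤) : T = ⊤ := by
  obtain ⟨c, hc⟩ := hnil
  have key : ∀ c, T ⊔ lowerCentral K L c = ⊤ := by
    intro c
    induction c with
    | zero => exact sup_top_eq T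
    | succ c ih =>
      rw [eq_top_iff, ← h]
      refine sup_le le_sup_left (Submodule.span_le.2 ?_)
      rintro _ ⟨a, -, b, -, rfl⟩
      obtain ⟨t, ht, g, hg, rfl⟩ := Submodule.mem_sup.1 (ih ▸ Submodule.mem_top (x := a))
      obtain ⟨t', ht', g', hg', rfl⟩ := Submodule.mem_sup.1 (ih ▸ Submodule.mem_top (x := b))
      rw [map_add bracket, LinearMap.add_apply, map_add (bracket t), add_assoc]
      exact Submodule.add_mem_sup (hT _ ht _ ht') (add_mem
        ((isGraded_lowerCentral K L c).bracket_mem_brk_swap hg')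
        (bracket_mem_brk hg Submodule.mem_top))
  rw [← key c, hc, sup_bot_eq]

end hom

section free

variable {K : Type u} [CommRing K] {X : Type w} {d : X → ZMod 2}

theorem span_freeGen_sup_derived :
    Submodule.span K (Set.range (freeGen K d)) ⊔ derived K (FreeLS K d) = ⊤ := by
  rw [eq_top_iff]
  rintro z -
  obtain ⟨a, rfl⟩ := (relIdeal K d).mkQ_surjective z
  induction a using Finsupp.induction_linear with
  | zero => rw [map_zero]; exact zero_mem _
  | add a b ha hb => rw [map_add]; exact add_mem ha hb
  | single w c =>
    rw [← mul_one c, ← smul_eq_mul, ← Finsupp.smul_single, map_smul]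
    refine Submodule.smul_mem _ _ ?_
    cases w with
    | of x => exact Submodule.mem_sup_left (Submodule.subset_span ⟨x, rfl⟩)
    | mul a b =>
      have : (relIdeal K d).mkQ (Finsupp.single (FreeMagma.mul a b) 1) =
          bracket (K := K) (L := FreeLS K d)
          ((relIdeal K d).mkQ (Finsupp.single a 1)) ((relIdeal K d).mkQ (Finsupp.single b 1)) := by
        change _ = (relIdeal K d).mkQ (mulWord K X _ _)
        simp [mulWord]
      rw [this]
      exact Submodule.mem_sup_right (bracket_mem_brk trivial trivial)

end free

/-! ### The upper bound for the Schur multiplier -/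

section upper

variable {K : Type u} {L : Type v} [Field K] [AddCommGroup L] [Module K L] [LieSuperalgebra K L]

variable (K L) in
theorem presMap_bracket (a b : PresF K L) :
    presMap K L (bracket (K := K) a b) = bracket (K := K) (presMap K L a) (presMap K L b) :=
  freeLift_bracket _ _ a b

variable (K L) in
theorem isGraded_ker_presMap : IsGraded (LinearMap.ker (presMap K L)) :=
  isGraded_ker fun i a ha => freeLift_mem _ _ i a ha

variable (K L) in
theorem multDen_le_ker : multDen K L ≤ LinearMap.ker (presMap K L) :=
  (multDen_le_multNum K L).trans inf_le_left

variable (K L) in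
/-- The bracket of `F` modulo `[R, F]` depends only on the classes in `L = F / R`. -/
theorem exists_multPairing : ∃ β : L →ₗ[K] L →ₗ[K] PresF K L ⧸ multDen K L,
    ∀ f g, β (presMap K L f) (presMap K L g) = (multDen K L).mkQ (bracket (K := K) f g) := by
  obtain ⟨σ, hσ⟩ := (presMap K L).exists_rightInverse_of_surjective
    (LinearMap.range_eq_top.2 (presMap_surjective K L))
  refine ⟨((bracket (K := K) (L := PresF K L)).compl₁₂ σ σ).compr₂ (multDen K L).mkQ,
    fun f g => ?_⟩
  have hker : ∀ f, σ (presMap K L f) - f ∈ LinearMap.ker (presMap K L) := by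
    intro f
    rw [LinearMap.mem_ker, map_sub, ← LinearMap.comp_apply, hσ, LinearMap.id_apply, sub_self]
  change (multDen K L).mkQ (bracket (K := K) (σ (presMap K L f)) (σ (presMap K L g))) = _
  rw [← sub_eq_zero, ← map_sub]
  refine (Submodule.Quotient.mk_eq_zero _).2 ?_
  have e : bracket (K := K) (σ (presMap K L f)) (σ (presMap K L g)) - bracket (K := K) f g =
      bracket (K := K) (σ (presMap K L f) - f) (σ (presMap K L g)) +
        bracket (K := K) f (σ (presMap K L g) - g) := by
    rw [map_sub bracket, LinearMap.sub_apply, map_sub (bracket f), sub_add_sub_cancel]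
  rw [e]
  exact add_mem (bracket_mem_brk (hker f) trivial)
    ((isGraded_ker_presMap K L).bracket_mem_brk_swap (hker g))

theorem isExteriorPairing_of_presMap {β : L →ₗ[K] L →ₗ[K] PresF K L ⧸ multDen K L}
    (hβ : ∀ f g, β (presMap K L f) (presMap K L g) = (multDen K L).mkQ (bracket (K := K) f g)) :
    IsExteriorPairing β := by
  have lift : ∀ i, ∀ a ∈ part (K := K) (L := L) i,
      ∃ f ∈ part (K := K) (L := PresF K L) i, presMap K L f = a :=
    fun i a ha => ⟨freeGen K _ (⟨(i, a), ha⟩ : HomogElt K L),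
      freeGen_mem (d := fun p : HomogElt K L => p.1.1) ⟨(i, a), ha⟩,
      freeLift_gen (d := fun p : HomogElt K L => p.1.1) _ _ _⟩
  constructor
  · intro i j x y hx hy
    obtain ⟨x, hx', rfl⟩ := lift i x hx
    obtain ⟨y, hy', rfl⟩ := lift j y hy
    rw [hβ, hβ, skew i j x y hx' hy', map_neg, map_smul]
  · intro i j k x y z hx hy hz
    obtain ⟨x, hx', rfl⟩ := lift i x hx
    obtain ⟨y, hy', rfl⟩ := lift j y hy
    obtain ⟨z, hz', rfl⟩ := lift k z hz
    simp only [← presMap_bracket, hβ]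
    rw [jacobi i j x y z hx' hy' ⟨k, hz'⟩, map_add, map_smul]

variable (K L) in
/-- `M(L) = (R ∩ F²) / [R, F]` is contained in the kernel of `F² / [R, F] → L²`. -/
theorem finrank_schurMultiplier_add_le [FiniteDimensional K L]
    [FiniteDimensional K ((derived K (PresF K L)).map (multDen K L).mkQ)] :
    FiniteDimensional K (SchurMultiplier K L) ∧
    Module.finrank K (SchurMultiplier K L) + Module.finrank K (derived K L) ≤
      Module.finrank K ((derived K (PresF K L)).map (multDen K L).mkQ) := by
  set N := (derived K (PresF K L)).map (multDen K L).mkQ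
  let κ : (PresF K L ⧸ multDen K L) →ₗ[K] L := (multDen K L).liftQ (presMap K L) (multDen_le_ker K L)
  let ι : SchurMultiplier K L →ₗ[K] (PresF K L ⧸ multDen K L) :=
    Submodule.mapQ _ (multDen K L) (multNum K L).subtype le_rfl
  have hι : Function.Injective ι := by
    rw [← LinearMap.ker_eq_bot]
    refine Submodule.ker_liftQ_eq_bot _ _ _ ?_
    rw [LinearMap.ker_comp, Submodule.ker_mkQ]
  have hrange : ∀ z, ι z ∈ N ⊓ LinearMap.ker κ := by
    intro z
    obtain ⟨⟨z, hz⟩, rfl⟩ := Submodule.mkQ_surjective _ z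
    exact ⟨⟨z, hz.2, rfl⟩, hz.1⟩
  let ι' : SchurMultiplier K L →ₗ[K] LinearMap.ker (κ.domRestrict N) :=
    LinearMap.codRestrict _ (LinearMap.codRestrict N ι fun z => (hrange z).1) fun z => (hrange z).2
  have hι' : Function.Injective ι' := by
    intro a b h
    exact hι (congrArg (fun z => (z.1 : PresF K L ⧸ multDen K L)) h)
  have hsurj : derived K L ≤ LinearMap.range (κ.domRestrict N) := by
    refine Submodule.span_le.2 ?_
    rintro _ ⟨a, -, b, -, rfl⟩
    obtain ⟨f, rfl⟩ := presMap_surjective K L a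
    obtain ⟨g, rfl⟩ := presMap_surjective K L b
    exact ⟨⟨_, bracket (K := K) f g, bracket_mem_brk trivial trivial, rfl⟩,
      presMap_bracket K L f g⟩
  refine ⟨Module.Finite.of_injective ι' hι', ?_⟩
  have h1 := LinearMap.finrank_range_add_finrank_ker (κ.domRestrict N)
  have h2 := LinearMap.finrank_le_finrank_of_injective hι'
  have h3 := Submodule.finrank_mono hsurj
  omega

end upper

/-! ### Nontriviality of the Schur multiplier -/

noncomputable section lower

variable {K : Type u} {L : Type v} [Field K] [AddCommGroup L] [Module K L] [LieSuperalgebra K L]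

/-- The degrees of two generators, of which `false` has degree `i` and `true` is odd. -/
def twoDeg (i : ZMod 2) (b : Bool) : ZMod 2 := cond b 1 i

theorem cond_mem_part {i : ZMod 2} {x y : L} (hx : x ∈ part (K := K) (L := L) i)
    (hy : y ∈ part (K := K) (L := L) 1) (b : Bool) :
    cond b y x ∈ part (K := K) (L := L) (twoDeg i b) := by
  cases b
  · exact hx
  · exact hy

variable (K) in
/-- The iterated bracket `[y, [y, …, [y, x]]]` of the two generators, with `k` letters `y`. -/
def iterBracket (i : ZMod 2) : ℕ → FreeLS K (twoDeg i)
  | 0 => freeGen K (twoDeg i) false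
  | k + 1 => bracket (K := K) (freeGen K (twoDeg i) true) (iterBracket i k)

variable (K) in
theorem iterBracket_mem (i : ZMod 2) (k : ℕ) :
    iterBracket K i k ∈ lowerCentral K (FreeLS K (twoDeg i)) k := by
  induction k with
  | zero => exact Submodule.mem_top
  | succ k ih => exact (isGraded_lowerCentral K _ k).bracket_mem_brk_swap ih

/-- In `ShiftModel` the iterated brackets do not vanish to arbitrary depth. -/
theorem iterBracket_notMem (i : ZMod 2) (k : ℕ) :
    iterBracket K i k ∉ lowerCentral K (FreeLS K (twoDeg i)) (k + 1) := by
  intro h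
  have hf := cond_mem_part (K := K) (ShiftModel.genSeq_zero_mem i) (ShiftModel.genY_mem (K := K) i)
  have hφ : ∀ k, freeLift K _ hf (iterBracket K i k) = ShiftModel.genSeq i k := by
    intro k
    induction k with
    | zero => exact freeLift_gen _ hf false
    | succ k ih =>
      rw [iterBracket, freeLift_bracket, ih, freeLift_gen]
      exact ShiftModel.bracket_genY_genSeq i k
  have h' := lowerCentral_le_comap (freeLift_bracket _ hf) (k + 1) h
  rw [Submodule.mem_comap, hφ] at h'
  exact ShiftModel.genSeq_notMem i k h'

/-- A nilpotent Lie superalgebra is not the quotient of the free Lie superalgebra on two generators,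
one of which is odd, by an ideal `R` with `R = [R, F]`. -/
theorem not_ker_le_brk_ker (hnil : IsNilpotent K L) {i : ZMod 2} {g : FreeLS K (twoDeg i) →ₗ[K] L}
    (hg : ∀ a b, g (bracket (K := K) a b) = bracket (K := K) (g a) (g b)) :
    ¬ LinearMap.ker g ≤ brk K (FreeLS K (twoDeg i)) (LinearMap.ker g) ⊤ := by
  intro hR
  have hle : ∀ c, LinearMap.ker g ≤ lowerCentral K (FreeLS K (twoDeg i)) c := by
    intro c
    induction c with
    | zero => exact le_top
    | succ c ih => exact hR.trans (brk_mono ih le_rfl)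
  obtain ⟨c, hc⟩ := hnil
  have h := lowerCentral_le_comap hg c (iterBracket_mem K i c)
  rw [hc] at h
  exact iterBracket_notMem i c (hle (c + 1) h)

/-- If `(R ∩ F²) = [R, F]` for the presentation of `L` on all of its homogeneous elements, then
`R' = [R', F']` for the kernel `R'` of the presentation `F' → L` on a minimal system of generators.
The inclusion `F' → F` has a retraction over `L`, and minimality gives `R' ⊆ F'²`. -/
theorem ker_le_brk_ker (h : multNum K L ≤ multDen K L) (hnil : IsNilpotent K L) {i : ZMod 2}
    {x y : L} (hx : x ∈ part (K := K) (L := L) i) (hy : y ∈ part (K := K) (L := L) 1)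
    (hgen : Submodule.span K {x, y} ⊔ derived K L = ⊤)
    (hind : ∀ a b : K, a • x + b • y ∈ derived K L → a = 0 ∧ b = 0) :
    LinearMap.ker (freeLift K _ (cond_mem_part hx hy)) ≤
      brk K (FreeLS K (twoDeg i)) (LinearMap.ker (freeLift K _ (cond_mem_part hx hy))) ⊤ := by
  set π := freeLift K _ (cond_mem_part hx hy)
  have hπb : ∀ a b, π (bracket (K := K) a b) = bracket (K := K) (π a) (π b) :=
    freeLift_bracket _ _
  have hπm : ∀ j, ∀ a ∈ part (K := K) (L := FreeLS K (twoDeg i)) j,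
      π a ∈ part (K := K) (L := L) j := freeLift_mem _ _
  have hπx : π (freeGen K _ false) = x := freeLift_gen _ (cond_mem_part hx hy) false
  have hπy : π (freeGen K _ true) = y := freeLift_gen _ (cond_mem_part hx hy) true
  have hsurj : LinearMap.range π = ⊤ := by
    refine eq_top_of_sup_derived hnil ?_ (eq_top_iff.2 (hgen ▸ sup_le_sup_right ?_ _))
    · rintro _ ⟨a, rfl⟩ _ ⟨b, rfl⟩
      exact ⟨_, hπb a b⟩
    · refine Submodule.span_le.2 ?_
      rintro _ (rfl | rfl)
      · exact ⟨_, hπx⟩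
      · exact ⟨_, hπy⟩
  let px : HomogElt K L := ⟨(i, x), hx⟩
  let py : HomogElt K L := ⟨(1, y), hy⟩
  have hne : px ≠ py := by
    intro e
    have e' : x = y := congrArg (fun p : HomogElt K L => p.1.2) e
    refine one_ne_zero (hind 1 (-1) ?_).1
    rw [e', one_smul, neg_one_smul, add_neg_cancel]
    exact zero_mem _
  -- Lifts to `F'` of the generators of `F`; those of `x` and `y` are the generators of `F'`.
  have hlift : ∀ p : HomogElt K L, ∃ f ∈ part (K := K) (L := FreeLS K (twoDeg i)) p.1.1,
      π f = p.1.2 ∧ (p = px → f = freeGen K _ false) ∧ (p = py → f = freeGen K _ true) := by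
    intro p
    by_cases h1 : p = px
    · subst h1
      exact ⟨_, freeGen_mem (d := twoDeg i) false, hπx, fun _ => rfl, fun e => absurd e hne⟩
    by_cases h2 : p = py
    · subst h2
      exact ⟨_, freeGen_mem (d := twoDeg i) true, hπy, fun e => absurd e h1, fun _ => rfl⟩
    obtain ⟨f, hf⟩ := LinearMap.range_eq_top.1 hsurj p.1.2
    obtain ⟨f', hf', e⟩ := exists_homog_preimage hπm f (hf.symm ▸ p.2)
    exact ⟨f', hf', e.trans hf, fun e => absurd e h1, fun e => absurd e h2⟩
  choose s hs hsπ hsx hsy using hlift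
  let ρ : PresF K L →ₗ[K] FreeLS K (twoDeg i) := freeLift K s hs
  have hρb : ∀ a b, ρ (bracket (K := K) a b) = bracket (K := K) (ρ a) (ρ b) :=
    freeLift_bracket _ _
  have hρg : ∀ p, ρ (freeGen K _ p) = s p := freeLift_gen _ _
  have hπρ : π.comp ρ = presMap K L := by
    refine free_hom_ext _ _ (fun a b => ?_) (presMap_bracket K L) fun p => ?_
    · simp only [LinearMap.comp_apply, hρb, hπb]
    · rw [LinearMap.comp_apply, hρg, hsπ]
      exact (freeLift_gen (L := L) (d := fun p : HomogElt K L => p.1.1) _ (fun p => p.2) p).symm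
  -- The homomorphism `F' → F`, of which `ρ` is a left inverse.
  let jgen : Bool → PresF K L := fun b => freeGen K _ (cond b py px)
  have hjgen : ∀ b, jgen b ∈ part (K := K) (L := PresF K L) (twoDeg i b) := by
    intro b
    cases b
    · exact freeGen_mem (d := fun p : HomogElt K L => p.1.1) px
    · exact freeGen_mem (d := fun p : HomogElt K L => p.1.1) py
  let J : FreeLS K (twoDeg i) →ₗ[K] PresF K L := freeLift K jgen hjgen
  have hJb : ∀ a b, J (bracket (K := K) a b) = bracket (K := K) (J a) (J b) :=
    freeLift_bracket _ _
  have hJg : ∀ b, J (freeGen K _ b) = jgen b := freeLift_gen _ _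
  have hρJ : ρ.comp J = LinearMap.id := by
    refine free_hom_ext _ _ (fun a b => ?_) (fun _ _ => rfl) fun b => ?_
    · simp only [LinearMap.comp_apply, hρb, hJb]
    · rw [LinearMap.comp_apply, hJg, hρg, LinearMap.id_apply]
      cases b
      · exact hsx px rfl
      · exact hsy py rfl
  intro r hr
  -- `x` and `y` are independent modulo `L²`, so `r` has no component of word length one.
  have hr2 : r ∈ derived K (FreeLS K (twoDeg i)) := by
    obtain ⟨t, ht, q, hq, rfl⟩ := Submodule.mem_sup.1
      ((span_freeGen_sup_derived (K := K) (d := twoDeg i)) ▸ Submodule.mem_top (x := r))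
    have hrange : Set.range (freeGen K (twoDeg i)) =
        {freeGen K (twoDeg i) false, freeGen K (twoDeg i) true} := by
      ext z
      simp
    rw [hrange] at ht
    obtain ⟨a, b, rfl⟩ := Submodule.mem_span_pair.1 ht
    rw [LinearMap.mem_ker, map_add, map_add, map_smul, map_smul, hπx, hπy,
      add_eq_zero_iff_eq_neg] at hr
    obtain ⟨rfl, rfl⟩ := hind a b (hr ▸ neg_mem (lowerCentral_le_comap hπb 1 hq))
    simpa using hq
  have hJr : J r ∈ multDen K L := by
    refine h ⟨?_, lowerCentral_le_comap hJb 1 hr2⟩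
    change presMap K L (J r) = 0
    rw [← hπρ, LinearMap.comp_apply, ← LinearMap.comp_apply ρ, hρJ]
    exact hr
  have hfin : ρ (J r) ∈ brk K (FreeLS K (twoDeg i)) (LinearMap.ker π) ⊤ := by
    refine map_brk_le hρb (fun a ha => ?_) (fun _ _ => Submodule.mem_top) hJr
    rw [Submodule.mem_comap, LinearMap.mem_ker, ← LinearMap.comp_apply, hπρ]
    exact ha
  rwa [← LinearMap.comp_apply, hρJ] at hfin

theorem nontrivial_schurMultiplier (hnil : IsNilpotent K L) {i : ZMod 2}
    {x y : L} (hx : x ∈ part (K := K) (L := L) i) (hy : y ∈ part (K := K) (L := L) 1)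
    (hgen : Submodule.span K {x, y} ⊔ derived K L = ⊤)
    (hind : ∀ a b : K, a • x + b • y ∈ derived K L → a = 0 ∧ b = 0) :
    Nontrivial (SchurMultiplier K L) := by
  rw [Submodule.Quotient.nontrivial_iff]
  intro htop
  refine not_ker_le_brk_ker hnil (freeLift_bracket _ (cond_mem_part hx hy))
    (ker_le_brk_ker (fun z hz => ?_) hnil hx hy hgen hind)
  have : (⟨z, hz⟩ : multNum K L) ∈ (multDen K L).comap (multNum K L).subtype :=
    htop ▸ Submodule.mem_top
  exact this

end lower

/-! ### Homogeneous generators -/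

section generators

variable {K : Type u} {L : Type v} [Field K] [AddCommGroup L] [Module K L] [LieSuperalgebra K L]
  [FiniteDimensional K L]

/-- A nilpotent Lie superalgebra with `dim L / L² = 2` and a nonzero odd part is generated by a
homogeneous element and an odd element, which are linearly independent modulo `L²`. -/
theorem exists_generators (hnil : IsNilpotent K L) (hodd : part (K := K) (L := L) 1 ≠ ⊥)
    (hdim : Module.finrank K L = Module.finrank K (derived K L) + 2) :
    ∃ i, ∃ x ∈ part (K := K) (L := L) i, ∃ y ∈ part (K := K) (L := L) 1,
      Submodule.span K {x, y} ⊔ derived K L = ⊤ ∧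
      ∀ a b : K, a • x + b • y ∈ derived K L → a = 0 ∧ b = 0 := by
  obtain ⟨y, hy, hyd⟩ := exists_odd_notMem_derived hnil hodd
  set N := derived K L
  have hlt : N < Submodule.span K {y} ⊔ N :=
    lt_of_le_of_ne le_sup_right fun e =>
      hyd (e ▸ Submodule.mem_sup_left (Submodule.mem_span_singleton_self y))
  have h1 := Submodule.finrank_lt_finrank_of_lt hlt
  have h1' := Submodule.finrank_add_le_finrank_add_finrank (Submodule.span K {y}) N
  rw [finrank_span_singleton (fun h0 => hyd (h0 ▸ zero_mem N) : y ≠ 0)] at h1'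
  obtain ⟨i, x, hx, hxd⟩ : ∃ i, ∃ x ∈ part (K := K) (L := L) i, x ∉ Submodule.span K {y} ⊔ N := by
    by_contra! hall
    have htop : (⊤ : Submodule K L) ≤ Submodule.span K {y} ⊔ N :=
      isGraded_top.le fun i a _ ha => hall i a ha
    have := Submodule.finrank_mono htop
    rw [finrank_top] at this
    omega
  refine ⟨i, x, hx, y, hy, ?_, fun a b hab => ?_⟩
  · have hle : Submodule.span K {y} ⊔ N ≤ Submodule.span K {x, y} ⊔ N :=
      sup_le_sup_right (Submodule.span_mono (by simp)) _
    have hlt2 : Submodule.span K {y} ⊔ N < Submodule.span K {x, y} ⊔ N :=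
      lt_of_le_of_ne hle fun e =>
        hxd (e ▸ Submodule.mem_sup_left (Submodule.subset_span (by simp)))
    have h2 := Submodule.finrank_lt_finrank_of_lt hlt2
    have h3 := Submodule.finrank_le (Submodule.span K {x, y} ⊔ N)
    exact Submodule.eq_top_of_finrank_eq (by omega)
  · have ha : a = 0 := by
      by_contra ha
      refine hxd ?_
      have hm : a • x ∈ Submodule.span K {y} ⊔ N := by
        rw [← add_sub_cancel_right (a • x) (b • y)]
        exact sub_mem (Submodule.mem_sup_right hab) (Submodule.mem_sup_left
          (Submodule.smul_mem _ _ (Submodule.mem_span_singleton_self y)))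
      exact (Submodule.smul_mem_iff _ ha).1 hm
    refine ⟨ha, ?_⟩
    by_contra hb
    rw [ha, zero_smul, zero_add] at hab
    exact hyd ((Submodule.smul_mem_iff _ hb).1 hab)

end generators

end LieSuperalgebra

/-! ### The bounds for `s(L)` -/

open LieSuperalgebra in
theorem theoremt1p16 {K : Type u} {L : Type v} [Field K] (h2 : (2 : K) ≠ 0)
    [AddCommGroup L] [Module K L] [LieSuperalgebra K L] [FiniteDimensional K L] (m n : ℕ)
    (hm : Module.finrank K (LieSuperalgebra.part (K := K) (L := L) 0) = m)
    (hn : Module.finrank K (LieSuperalgebra.part (K := K) (L := L) 1) = n)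
    (hnil : LieSuperalgebra.IsNilpotent K L) (hdim : 2 < m + n) (hn1 : 1 ≤ n)
    (hL2 : Module.finrank K (LieSuperalgebra.derived K L) = m + n - 2) :
    ((n : ℚ) + m) * ((n : ℚ) + m - 5) + 8 ≤ 2 * LieSuperalgebra.sInv K L ∧
      2 * LieSuperalgebra.sInv K L < ((n : ℚ) + m) * ((n : ℚ) + m - 1) - 2 * m + 4 := by
  have htot : Module.finrank K L = m + n := by
    rw [← hm, ← hn, Submodule.finrank_add_eq_of_isCompl isCompl]
  have hodd : part (K := K) (L := L) 1 ≠ ⊥ := by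
    intro h
    rw [h, finrank_bot] at hn
    omega
  have hL : derived K L ≠ ⊥ := by
    intro h
    rw [h, finrank_bot] at hL2
    omega
  obtain ⟨i, x, hx, y, hy, hgen, hind⟩ := exists_generators hnil hodd (by omega)
  obtain ⟨β, hβ⟩ := exists_multPairing K L
  have hN : (derived K (PresF K L)).map (multDen K L).mkQ ≤
      Submodule.span K {q | ∃ a b, q = β a b} := by
    rw [Submodule.map_le_iff_le_comap]
    refine Submodule.span_le.2 ?_
    rintro _ ⟨f, -, g, -, rfl⟩
    exact Submodule.subset_span ⟨_, _, (hβ f g).symm⟩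
  obtain ⟨hfd, hle⟩ := (isExteriorPairing_of_presMap hβ).finrank_le h2 hnil hgen hx hy hL hN
  obtain ⟨hfdM, hM⟩ := finrank_schurMultiplier_add_le K L
  have hpos : 0 < Module.finrank K (SchurMultiplier K L) := by
    have := nontrivial_schurMultiplier hnil hx hy hgen hind
    exact Module.finrank_pos
  -- If both generators are odd, they are independent in the odd part.
  have hin : i.val + 1 ≤ n := by
    rcases zmodTwo_cases i with rfl | rfl
    · exact hn1
    have hli : LinearIndependent K ![x, y] := by
      refine LinearIndependent.pair_iff.2 fun a b hab => hind a b ?_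
      rw [hab]
      exact zero_mem _
    have hsp : Submodule.span K (Set.range ![x, y]) ≤ part (K := K) (L := L) 1 := by
      refine Submodule.span_le.2 ?_
      rintro _ ⟨k, rfl⟩
      fin_cases k
      · exact hx
      · exact hy
    have h := Submodule.finrank_mono hsp
    rw [finrank_span_eq_card hli, hn] at h
    exact h
  have hupper : Module.finrank K (SchurMultiplier K L) + 2 ≤ m + 2 * n := by omega
  have hs : 2 * sInv K L = ((m : ℚ) + n - 2) * (m + n - 1) + 2 * n + 2 -
      2 * Module.finrank K (SchurMultiplier K L) := by
    simp only [sInv, hm, hn]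
    ring
  have hupperQ : (Module.finrank K (SchurMultiplier K L) : ℚ) + 2 ≤ m + 2 * n := by
    exact_mod_cast hupper
  have hposQ : (0 : ℚ) < Module.finrank K (SchurMultiplier K L) := by exact_mod_cast hpos
  rw [hs]
  constructor <;> linarith
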